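/- Let $p$ be a prime. A $p$-Lie algebra of finite Morley rank is a Lie algebra $\mathfrak a$ over $\mathbb F_p$ with a $p$-map $\phi : x \mapsto x^{p}$ in the sense of restricted Lie algebras, that is the underlying set of a first-order structure of finite Morley rank in which $+$, $[\cdot,\cdot]$ and $\phi$ are definable (definable means definable with parameters). A $p$-subalgebra is a Lie subalgebra stable under $\phi$. A $p$-subalgebra $\mathfrak u$ is $p$-nilpotent if for every $x \in \mathfrak u$ there is $i \in \mathbb N$ with $\phi^{i}(x)=0$, and it is of bounded exponent if there is $N \in \mathbb N$ with $\phi^{N}(x)=0$ for all $x \in \mathfrak u$. A $p$-torus is an abelian $p$-subalgebra $\mathfrak t$ with $\phi(\mathfrak t)=\mathfrak t$. Write $\mathfrak a = \mathfrak u \oplus \mathfrak t$ if $\mathfrak a = \mathfrak u + \mathfrak t$ and $\mathfrak u \cap \mathfrak t = 0$, and $\mathfrak a = \mathfrak u\,(+)\,\mathfrak t$ if $\mathfrak a = \mathfrak u + \mathfrak t$ and $\mathfrak u \cap \mathfrak t$ is finite. Let $\mathfrak a$ be an abelian $p$-Lie algebra of finite Morley rank. Then: 1. $\mathfrak a = \mathfrak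 u \oplus \mathfrak t$ for some $p$-nilpotent $p$-subalgebra $\mathfrak u$ of bounded exponent and some $p$-torus $\mathfrak t$. 2. $\mathfrak a = \mathfrak u\,(+)\,\mathfrak t$ for some definable $p$-nilpotent $p$-subalgebra $\mathfrak u$ of bounded exponent and some definable $p$-torus $\mathfrak t$. -/

import Mathlib

open scoped TensorProduct

universe u v w

/-! ### Finite Morley rank -/

/-- `MorleyRankGE L n M ψ` says that the set defined in `M` by the formula `ψ` (in the variables
`α`, with parameters from `M`) has Morley rank at least `n`:
it has rank `≥ 0` if it is nonempty, and rank `≥ n + 1` if in some elementary extension `N` of `M`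
the set defined by `ψ` contains infinitely many pairwise disjoint sets, definable with parameters
from `N`, of rank `≥ n`.  Passing to elementary extensions makes the notion independent of any
saturation of `M`.  Extensions in the universe of `M` suffice, by the downward
Löwenheim-Skolem theorem applied to the language up to `M`-equivalence. -/
def MorleyRankGE (L : FirstOrder.Language.{u, v}) {α : Type} :
    ℕ → ∀ (M : Type w) [L.Structure M], L.Formula (M ⊕ α) → Prop
  | 0, M, _, ψ => ∃ x : α → M, ψ.Realize (Sum.elim id x)
  | n + 1, M, _, ψ =>
      ∃ (N : Type w) (_ : L.Structure N) (f : L.ElementaryEmbedding M N) (θ : ℕ → L.Formula (N ⊕ α)),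
        (∀ i, MorleyRankGE L n N (θ i)) ∧
        (∀ i j, i ≠ j → ∀ x : α → N,
          ¬ ((θ i).Realize (Sum.elim id x) ∧ (θ j).Realize (Sum.elim id x))) ∧
        (∀ i, ∀ x : α → N, (θ i).Realize (Sum.elim id x) → ψ.Realize (Sum.elim f x))

/-- The structure `M` has finite Morley rank: the Morley rank of the formula `x = x` in one
variable is not `≥ n` for some natural number `n`. -/
def HasFiniteMorleyRank (L : FirstOrder.Language.{u, v}) (M : Type w) [L.Structure M] : Prop :=
  ∃ n : ℕ, ¬ MorleyRankGE L n M (⊤ : L.Formula (M ⊕ Fin 1))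

/-- A subset of the structure `M` is definable (with parameters from `M`). -/
def IsDefinableSet (L : FirstOrder.Language.{u, v}) {M : Type w} [L.Structure M] (S : Set M) :
    Prop :=
  (Set.univ : Set M).Definable₁ L S

/-! ### Restricted Lie algebras -/

/-- `φ` is a `p`-map on the Lie algebra `g` over a field `K` of characteristic `p`.  In the
third condition, `K[X] ⊗ g` is the Lie algebra over `K[X]` obtained by extension of scalars. -/
structure IsPMap (p : ℕ) (K : Type u) [Field K] [CharP K p] {g : Type v} [LieRing g]
    [LieAlgebra K g] (φ : g → g) : Prop where
  lie_pmap : ∀ x y : g, ⁅φ x, y⁆ = ((LieAlgebra.ad K g x) ^ p) y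
  pmap_smul : ∀ (c : K) (x : g), φ (c • x) = c ^ p • φ x
  pmap_add : ∀ x y : g, ∃ s : ℕ → g,
    ((LieAlgebra.ad (Polynomial K) (Polynomial K ⊗[K] g)
        ((Polynomial.X : Polynomial K) ⊗ₜ[K] x + (1 : Polynomial K) ⊗ₜ[K] y)) ^ (p - 1))
          ((1 : Polynomial K) ⊗ₜ[K] x) =
      ∑ i ∈ Finset.Icc 1 (p - 1), ((Polynomial.X : Polynomial K) ^ (i - 1)) ⊗ₜ[K] (i • s i) ∧
    φ (x + y) = φ x + φ y + ∑ i ∈ Finset.Icc 1 (p - 1), s i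

/-- A `p`-Lie algebra of finite Morley rank: a Lie algebra `g` over `𝔽_p` with a `p`-map `φ`,
carried by a first-order structure of finite Morley rank (in some language `L`) in which the
addition, the bracket and the `p`-map are definable. -/
structure IsPLieAlgebraOfFiniteMorleyRank (p : ℕ) [Fact p.Prime]
    (L : FirstOrder.Language.{u, v}) (g : Type w) [LieRing g] [LieAlgebra (ZMod p) g]
    [L.Structure g] (φ : g → g) : Prop where
  isPMap : IsPMap p (ZMod p) φ
  definable_add : (Set.univ : Set g).Definable L {a : Fin 3 → g | a 0 + a 1 = a 2}
  definable_lie : (Set.univ : Set g).Definable L {a : Fin 3 → g | ⁅a 0, a 1⁆ = a 2}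
  definable_pmap : (Set.univ : Set g).Definable L {a : Fin 2 → g | φ (a 0) = a 1}
  finite_rank : HasFiniteMorleyRank L g

section Subalgebras

variable {K : Type u} [CommRing K] {g : Type v} [LieRing g] [LieAlgebra K g]

/-- A `p`-subalgebra: a subalgebra stable under the `p`-map. -/
def IsPSubalgebra (φ : g → g) (h : LieSubalgebra K g) : Prop :=
  ∀ x ∈ h, φ x ∈ h

/-- A `p`-subalgebra is `p`-nilpotent if each of its elements is killed by an iterate of the
`p`-map. -/
def IsPNilpotent (φ : g → g) (h : LieSubalgebra K g) : Prop :=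
  IsPSubalgebra φ h ∧ ∀ x ∈ h, ∃ i : ℕ, φ^[i] x = 0

/-- A `p`-subalgebra has bounded exponent if one iterate of the `p`-map kills it. -/
def HasBoundedExponent (φ : g → g) (h : LieSubalgebra K g) : Prop :=
  ∃ N : ℕ, ∀ x ∈ h, φ^[N] x = 0

/-- A `p`-torus: an abelian `p`-subalgebra `t` that is `p`-divisible, that is, every element of
`t` is `φ` of an element of `t`. -/
def IsPTorus (φ : g → g) (t : LieSubalgebra K g) : Prop :=
  IsPSubalgebra φ t ∧ IsLieAbelian t ∧ φ '' (t : Set g) = (t : Set g)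

/-- `g` is the (internal) direct sum of `h` and `k`. -/
def IsInternalDirectSum (h k : LieSubalgebra K g) : Prop :=
  IsCompl h.toSubmodule k.toSubmodule

/-- `g = h (+) k`: `g` is the sum of `h` and `k`, and `h ∩ k` is finite. -/
def IsAlmostDirectSum (h k : LieSubalgebra K g) : Prop :=
  h.toSubmodule ⊔ k.toSubmodule = ⊤ ∧ ((h : Set g) ∩ (k : Set g)).Finite

end Subalgebras

/-! Since `𝔞` is abelian, the `p`-map is an `𝔽_p`-linear endomorphism `f` with definable graph
(`IsPMap.map_add_of_isLieAbelian`). The ranges of `f ^ n` form a descending chain of definable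
subgroups, so they stabilise at some `N`, and the torus is the range of `f ^ N`.

Definable version: take the kernel of `f ^ N`. Fitting's argument gives the sum. The intersection is
finite: `f` is onto on the torus, so an infinite kernel there would produce subgroups `t ∩ ker f ^
(N * n)`, each of infinite index in the next, and ranks would be unbounded.

Direct sum version: Zorn's lemma yields an `f`-invariant complement of the torus, with no claim of
definability.

Both chain conditions rest on the monotonicity of Morley rank under definable injections, which
makes cosets as large as their subgroup. -/

/-! ### Morley rank under definable injections. -/

/-- `χ` defines a relation which restricts to the graph of an injection from the set defined
by `ψ` to the set defined by `ψ'`, up to multivaluedness. -/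
structure DefinesInjection (L : FirstOrder.Language.{u, v}) (M : Type w) [L.Structure M]
    (ψ ψ' : L.Formula (M ⊕ Fin 1)) (χ : L.Formula (M ⊕ (Fin 1 ⊕ Fin 1))) : Prop where
  total : ∀ x : Fin 1 → M, ψ.Realize (Sum.elim id x) →
    ∃ y : Fin 1 → M, χ.Realize (Sum.elim id (Sum.elim x y))
  mapsTo : ∀ x y : Fin 1 → M, ψ.Realize (Sum.elim id x) →
    χ.Realize (Sum.elim id (Sum.elim x y)) → ψ'.Realize (Sum.elim id y)
  inj : ∀ x x' y : Fin 1 → M, ψ.Realize (Sum.elim id x) → ψ.Realize (Sum.elim id x') →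
    χ.Realize (Sum.elim id (Sum.elim x y)) → χ.Realize (Sum.elim id (Sum.elim x' y)) → x = x'

section

variable {L : FirstOrder.Language.{u, v}}

open FirstOrder FirstOrder.Language

/-- Each of the three clauses is a first-order sentence with parameters in `M`, hence survives in an
elementary extension. This is needed because Morley rank is witnessed in such extensions. -/
theorem DefinesInjection.map {M : Type w} [L.Structure M] {N : Type w} [L.Structure N]
    (f : M ↪ₑ[L] N) {ψ ψ' : L.Formula (M ⊕ Fin 1)} {χ : L.Formula (M ⊕ (Fin 1 ⊕ Fin 1))}
    (h : DefinesInjection L M ψ ψ' χ) :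
    DefinesInjection L N (ψ.relabel (Sum.map f id)) (ψ'.relabel (Sum.map f id))
      (χ.relabel (Sum.map f id)) := by
  have e1 : ∀ x : Fin 1 → N, Sum.elim id x ∘ Sum.map f id = Sum.elim (f : M → N) x := by
    intro x; ext i; rcases i with i | i <;> rfl
  have e2 : ∀ x : Fin 1 ⊕ Fin 1 → N,
      Sum.elim id x ∘ Sum.map f id = Sum.elim (f : M → N) x := by
    intro x; ext i; rcases i with i | i <;> rfl
  refine ⟨?_, ?_, ?_⟩
  · let Φ : L.Formula M := Formula.iAlls (Fin 1)
      (ψ.imp (Formula.iExs (Fin 1) (χ.relabel (Equiv.sumAssoc M (Fin 1) (Fin 1)).symm)))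
    have e3 : ∀ {A : Type w} (g : M → A) (x y : Fin 1 → A),
        Sum.elim (Sum.elim g x) y ∘ (Equiv.sumAssoc M (Fin 1) (Fin 1)).symm =
          Sum.elim g (Sum.elim x y) := by
      intro A g x y; ext i; rcases i with i | i | i <;> rfl
    have key := (f.map_formula Φ id).2 (by
      simp only [Φ, Formula.realize_iAlls, Formula.realize_imp, Formula.realize_iExs,
        Formula.realize_relabel, e3]
      exact h.total)
    simp only [Φ, Formula.realize_iAlls, Formula.realize_imp, Formula.realize_iExs,
        Formula.realize_relabel, e3, Function.comp_id] at key
    simpa only [Formula.realize_relabel, e1, e2] using key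
  · let Φ : L.Formula M := Formula.iAlls (Fin 1 ⊕ Fin 1)
      ((ψ.relabel (Sum.map id Sum.inl)).imp (χ.imp (ψ'.relabel (Sum.map id Sum.inr))))
    have e3 : ∀ {A : Type w} (g : M → A) (x : Fin 1 ⊕ Fin 1 → A),
        Sum.elim g x ∘ Sum.map id Sum.inl = Sum.elim g (x ∘ Sum.inl) := by
      intro A g x; ext i; rcases i with i | i <;> rfl
    have e4 : ∀ {A : Type w} (g : M → A) (x : Fin 1 ⊕ Fin 1 → A),
        Sum.elim g x ∘ Sum.map id Sum.inr = Sum.elim g (x ∘ Sum.inr) := by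
      intro A g x; ext i; rcases i with i | i <;> rfl
    have key := (f.map_formula Φ id).2 (by
      simp only [Φ, Formula.realize_iAlls, Formula.realize_imp,
        Formula.realize_relabel, e3, e4]
      intro x h1 h2
      refine h.mapsTo _ _ h1 ?_
      rwa [Sum.elim_comp_inl_inr])
    simp only [Φ, Formula.realize_iAlls, Formula.realize_imp,
        Formula.realize_relabel, e3, e4, Function.comp_id] at key
    simp only [Formula.realize_relabel, e1, e2]
    intro x y
    exact key (Sum.elim x y)
  · let t : Fin 1 ⊕ Fin 1 ⊕ Fin 1 → L.Term (M ⊕ (Fin 1 ⊕ Fin 1 ⊕ Fin 1)) :=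
      fun i => Term.var (Sum.inr i)
    let Φ : L.Formula M := Formula.iAlls (Fin 1 ⊕ Fin 1 ⊕ Fin 1)
      ((ψ.relabel (Sum.map id Sum.inl)).imp
        ((ψ.relabel (Sum.map id (Sum.inr ∘ Sum.inl))).imp
          ((χ.relabel (Sum.map id (Sum.elim Sum.inl (Sum.inr ∘ Sum.inr)))).imp
            ((χ.relabel (Sum.map id (Sum.elim (Sum.inr ∘ Sum.inl) (Sum.inr ∘ Sum.inr)))).imp
              ((t (Sum.inl 0)).equal (t (Sum.inr (Sum.inl 0))))))))
    have e3 : ∀ {A : Type w} {β : Type} (g : M → A) (x : Fin 1 ⊕ Fin 1 ⊕ Fin 1 → A)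
        (k : β → Fin 1 ⊕ Fin 1 ⊕ Fin 1),
        Sum.elim g x ∘ Sum.map id k = Sum.elim g (x ∘ k) := by
      intro A β g x k; ext i; rcases i with i | i <;> rfl
    have e4 : ∀ {A : Type w} (x : Fin 1 ⊕ Fin 1 ⊕ Fin 1 → A)
        (k k' : Fin 1 → Fin 1 ⊕ Fin 1 ⊕ Fin 1),
        x ∘ Sum.elim k k' = Sum.elim (x ∘ k) (x ∘ k') := by
      intro A x k k'; ext i; rcases i with i | i <;> rfl
    have key := (f.map_formula Φ id).2 (by
      simp only [Φ, Formula.realize_iAlls, Formula.realize_imp, Formula.realize_equal,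
        Formula.realize_relabel, e3, e4]
      intro x h1 h2 h3 h4
      exact congrFun (h.inj _ _ _ h1 h2 h3 h4) 0)
    simp only [Φ, Formula.realize_iAlls, Formula.realize_imp, Formula.realize_equal,
        Formula.realize_relabel, e3, e4, Function.comp_id] at key
    simp only [Formula.realize_relabel, e1, e2]
    intro x x' y h1 h2 h3 h4
    have := key (Sum.elim x (Sum.elim x' y)) h1 h2 h3 h4
    ext i
    rw [Subsingleton.elim i 0]
    exact this

/-- By induction on the rank: push the disjoint witnesses forward along the relation, inside the
extension where they live. Injectivity keeps the images disjoint. -/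
theorem MorleyRankGE.of_definesInjection (n : ℕ) : ∀ (M : Type w) [L.Structure M]
    (ψ ψ' : L.Formula (M ⊕ Fin 1)) (χ : L.Formula (M ⊕ (Fin 1 ⊕ Fin 1))),
    DefinesInjection L M ψ ψ' χ → MorleyRankGE L n M ψ → MorleyRankGE L n M ψ' := by
  induction n with
  | zero =>
    rintro M _ ψ ψ' χ h ⟨x, hx⟩
    obtain ⟨y, hy⟩ := h.total x hx
    exact ⟨y, h.mapsTo x y hx hy⟩
  | succ n ih =>
    rintro M _ ψ ψ' χ h ⟨N, _, f, θ, hr, hd, hs⟩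
    have hN := h.map f
    have e1 : ∀ x : Fin 1 → N, Sum.elim id x ∘ Sum.map f id = Sum.elim (f : M → N) x := by
      intro x; ext i; rcases i with i | i <;> rfl
    have hs' : ∀ i x, (θ i).Realize (Sum.elim id x) →
        (ψ.relabel (Sum.map f id)).Realize (Sum.elim (id : N → N) x) := by
      intro i x hx
      rw [Formula.realize_relabel, e1]
      exact hs i x hx
    let χN : L.Formula (N ⊕ (Fin 1 ⊕ Fin 1)) := χ.relabel (Sum.map f id)
    -- The image formula quantifies over the source point, so the source variable moves to the outer
    -- summand and the target variable stays free.
    let r : N ⊕ (Fin 1 ⊕ Fin 1) → (N ⊕ Fin 1) ⊕ Fin 1 :=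
      Sum.elim (Sum.inl ∘ Sum.inl) (Sum.elim Sum.inr (Sum.inl ∘ Sum.inr))
    let r' : N ⊕ Fin 1 → (N ⊕ Fin 1) ⊕ Fin 1 := Sum.elim (Sum.inl ∘ Sum.inl) Sum.inr
    let θ' : ℕ → L.Formula (N ⊕ Fin 1) := fun i =>
      Formula.iExs (Fin 1) ((θ i).relabel r' ⊓ χN.relabel r)
    have er : ∀ x y : Fin 1 → N,
        Sum.elim (Sum.elim id y) x ∘ r = Sum.elim id (Sum.elim x y) := by
      intro x y; ext i; rcases i with i | i | i <;> rfl
    have er' : ∀ x y : Fin 1 → N, Sum.elim (Sum.elim id y) x ∘ r' = Sum.elim id x := by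
      intro x y; ext i; rcases i with i | i <;> rfl
    have hθ' : ∀ i y, (θ' i).Realize (Sum.elim id y) ↔ ∃ x, (θ i).Realize (Sum.elim id x) ∧
        χN.Realize (Sum.elim id (Sum.elim x y)) := by
      intro i y
      simp only [θ', Formula.realize_iExs, Formula.realize_inf, Formula.realize_relabel, er, er']
    refine ⟨N, inferInstance, f, θ', fun i => ih N (θ i) (θ' i) χN ⟨?_, ?_, ?_⟩ (hr i), ?_, ?_⟩
    · intro x hx
      exact hN.total x (hs' i x hx)
    · intro x y hx hy
      exact (hθ' i y).2 ⟨x, hx, hy⟩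
    · intro x x' y hx hx' hy hy'
      exact hN.inj x x' y (hs' i x hx) (hs' i x' hx') hy hy'
    · rintro i j hij y ⟨h1, h2⟩
      obtain ⟨x, hx, hxy⟩ := (hθ' i y).1 h1
      obtain ⟨x', hx', hxy'⟩ := (hθ' j y).1 h2
      obtain rfl := hN.inj x x' y (hs' i x hx) (hs' j x' hx') hxy hxy'
      exact hd i j hij x ⟨hx, hx'⟩
    · intro i y hy
      obtain ⟨x, hx, hxy⟩ := (hθ' i y).1 hy
      have := hN.mapsTo x y (hs' i x hx) hxy
      rwa [Formula.realize_relabel, e1] at this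

end

/-! ### Definable sets and their rank inside a fixed structure. -/

section

variable {L : FirstOrder.Language.{u, v}} {M : Type w} [L.Structure M]

open FirstOrder FirstOrder.Language

theorem definable_univ_iff_exists_formula {α : Type} {S : Set (α → M)} :
    (Set.univ : Set M).Definable L S ↔
      ∃ ψ : L.Formula (M ⊕ α), ∀ x, ψ.Realize (Sum.elim id x) ↔ x ∈ S := by
  rw [Set.definable_iff_exists_formula_sum]
  constructor
  · rintro ⟨ψ, rfl⟩
    refine ⟨ψ.relabel (Sum.map (↑) id), fun x => ?_⟩
    rw [Formula.realize_relabel]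
    have : Sum.elim id x ∘ Sum.map ((↑) : ↥(Set.univ : Set M) → M) id = Sum.elim (↑) x := by
      ext i; rcases i with i | i <;> rfl
    rw [this]
    rfl
  · rintro ⟨ψ, h⟩
    refine ⟨ψ.relabel (Sum.map (fun a => ⟨a, trivial⟩) id), ?_⟩
    ext x
    rw [Set.mem_ofPred_eq, Formula.realize_relabel, ← h x]
    have : Sum.elim ((↑) : ↥(Set.univ : Set M) → M) x ∘ Sum.map (fun a => ⟨a, trivial⟩) id =
        Sum.elim id x := by
      ext i; rcases i with i | i <;> rfl
    rw [this]

/-- The graph of `f` is definable with parameters. -/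
def HasDefinableGraph (L : FirstOrder.Language.{u, v}) {M : Type w} [L.Structure M]
    (f : M → M) : Prop :=
  (Set.univ : Set M).Definable L {a : Fin 2 → M | f (a 0) = a 1}

theorem isDefinableSet_singleton (c : M) : IsDefinableSet L ({c} : Set M) := by
  refine definable_univ_iff_exists_formula.2
    ⟨((Term.var (Sum.inr 0) : L.Term (M ⊕ Fin 1)).equal (Term.var (Sum.inl c))), fun x => ?_⟩
  simp [Formula.realize_equal]

theorem IsDefinableSet.inter {S T : Set M} (hS : IsDefinableSet L S) (hT : IsDefinableSet L T) :
    IsDefinableSet L (S ∩ T) :=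
  Set.Definable.inter hS hT

theorem isDefinableSet_univ : IsDefinableSet L (Set.univ : Set M) := by
  have : (Set.univ : Set M).Definable L (Set.univ : Set (Fin 1 → M)) := Set.definable_univ
  exact this

theorem HasDefinableGraph.definable_and_mem {f : M → M} (hf : HasDefinableGraph L f) (i : Fin 2)
    {S : Set M} (hS : IsDefinableSet L S) :
    (Set.univ : Set M).Definable L {a : Fin 2 → M | f (a 0) = a 1 ∧ a i ∈ S} :=
  Set.Definable.inter hf (Set.Definable.preimage_comp (fun _ : Fin 1 => i) hS)

theorem IsDefinableSet.image {f : M → M} (hf : HasDefinableGraph L f) {S : Set M}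
    (hS : IsDefinableSet L S) : IsDefinableSet L (f '' S) := by
  have h := (hf.definable_and_mem 0 hS).image_comp (fun _ : Fin 1 => (1 : Fin 2))
  unfold IsDefinableSet Set.Definable₁
  convert h using 1
  ext x
  constructor
  · rintro ⟨y, hy, hyx⟩
    refine ⟨![y, x 0], ⟨hyx, hy⟩, ?_⟩
    ext i
    rw [Subsingleton.elim i 0]
    rfl
  · rintro ⟨a, ⟨h1, h2⟩, rfl⟩
    exact ⟨a 0, h2, h1⟩

theorem IsDefinableSet.preimage {f : M → M} (hf : HasDefinableGraph L f) {S : Set M}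
    (hS : IsDefinableSet L S) : IsDefinableSet L (f ⁻¹' S) := by
  have h := (hf.definable_and_mem 1 hS).image_comp (fun _ : Fin 1 => (0 : Fin 2))
  unfold IsDefinableSet Set.Definable₁
  convert h using 1
  ext x
  constructor
  · intro hx
    refine ⟨![x 0, f (x 0)], ⟨rfl, hx⟩, ?_⟩
    ext i
    rw [Subsingleton.elim i 0]
    rfl
  · rintro ⟨a, ⟨h1, h2⟩, rfl⟩
    show f (a 0) ∈ S
    rwa [h1]

theorem IsDefinableSet.image_iterate {f : M → M} (hf : HasDefinableGraph L f) {S : Set M}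
    (hS : IsDefinableSet L S) (n : ℕ) : IsDefinableSet L (f^[n] '' S) := by
  induction n with
  | zero => simpa using hS
  | succ n ih =>
    rw [Function.iterate_succ', Set.image_comp]
    exact ih.image hf

theorem IsDefinableSet.preimage_iterate {f : M → M} (hf : HasDefinableGraph L f) {S : Set M}
    (hS : IsDefinableSet L S) (n : ℕ) : IsDefinableSet L (f^[n] ⁻¹' S) := by
  induction n with
  | zero => simpa using hS
  | succ n ih =>
    rw [Function.iterate_succ, Set.preimage_comp]
    exact ih.preimage hf

/-- The definable set `S` has Morley rank at least `n`. -/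
def HasMorleyRankGE (L : FirstOrder.Language.{u, v}) {M : Type w} [L.Structure M] (n : ℕ)
    (S : Set M) : Prop :=
  ∃ ψ : L.Formula (M ⊕ Fin 1), (∀ x, ψ.Realize (Sum.elim id x) ↔ x 0 ∈ S) ∧ MorleyRankGE L n M ψ

theorem HasMorleyRankGE.zero {S : Set M} (hS : IsDefinableSet L S) (hne : S.Nonempty) :
    HasMorleyRankGE L 0 S := by
  obtain ⟨ψ, hψ⟩ := definable_univ_iff_exists_formula.1 hS
  obtain ⟨a, ha⟩ := hne
  exact ⟨ψ, hψ, fun _ => a, (hψ _).2 ha⟩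

/-- The trivial extension of `M` already serves as witness, so no elementary extensions appear from
here on. -/
theorem HasMorleyRankGE.succ {n : ℕ} {S : Set M} (hS : IsDefinableSet L S) (T : ℕ → Set M)
    (hT : ∀ i, HasMorleyRankGE L n (T i)) (hTS : ∀ i, T i ⊆ S)
    (hd : Pairwise fun i j => Disjoint (T i) (T j)) : HasMorleyRankGE L (n + 1) S := by
  obtain ⟨ψ, hψ⟩ := definable_univ_iff_exists_formula.1 hS
  choose θ hθ hr using hT
  refine ⟨ψ, hψ, M, inferInstance, ElementaryEmbedding.refl L M, θ, hr, ?_, ?_⟩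
  · rintro i j hij x ⟨h1, h2⟩
    exact Set.disjoint_left.1 (hd hij) ((hθ i x).1 h1) ((hθ j x).1 h2)
  · intro i x hx
    exact (hψ x).2 (hTS i ((hθ i x).1 hx))

theorem HasMorleyRankGE.of_injOn {n : ℕ} {S T : Set M} (h : HasMorleyRankGE L n S)
    (hT : IsDefinableSet L T) {f : M → M} (hf : HasDefinableGraph L f) (hST : Set.MapsTo f S T)
    (hi : Set.InjOn f S) : HasMorleyRankGE L n T := by
  obtain ⟨ψ, hψ, hr⟩ := h
  obtain ⟨ψ', hψ'⟩ := definable_univ_iff_exists_formula.1 hT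
  obtain ⟨χ, hχ⟩ := definable_univ_iff_exists_formula.1 hf
  let r : M ⊕ Fin 2 → M ⊕ (Fin 1 ⊕ Fin 1) := Sum.map id ![Sum.inl 0, Sum.inr 0]
  have hr' : ∀ x y : Fin 1 → M,
      (χ.relabel r).Realize (Sum.elim id (Sum.elim x y)) ↔ f (x 0) = y 0 := by
    intro x y
    rw [Formula.realize_relabel]
    have : Sum.elim id (Sum.elim x y) ∘ r = Sum.elim id ![x 0, y 0] := by
      ext i
      rcases i with i | i
      · rfl
      · fin_cases i <;> rfl
    rw [this, hχ]
    rfl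
  refine ⟨ψ', hψ', MorleyRankGE.of_definesInjection n M ψ ψ' (χ.relabel r) ⟨?_, ?_, ?_⟩ hr⟩
  · intro x _
    exact ⟨fun _ => f (x 0), (hr' _ _).2 rfl⟩
  · intro x y hx hxy
    refine (hψ' y).2 ?_
    show y 0 ∈ T
    rw [← (hr' x y).1 hxy]
    exact hST ((hψ x).1 hx)
  · intro x x' y hx hx' hxy hxy'
    ext i
    rw [Subsingleton.elim i 0]
    exact hi ((hψ x).1 hx) ((hψ x').1 hx') (((hr' x y).1 hxy).trans ((hr' x' y).1 hxy').symm)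

/-- The inclusion of a definable set into `M` is a definable injection, given by equality, so the
bound for `M` is uniform over its subsets. -/
theorem HasFiniteMorleyRank.exists_not_hasMorleyRankGE (h : HasFiniteMorleyRank L M) :
    ∃ n, ∀ S : Set M, ¬ HasMorleyRankGE L n S := by
  obtain ⟨n, hn⟩ := h
  refine ⟨n, fun S hS => hn ?_⟩
  obtain ⟨ψ, hψ, hr⟩ := hS
  refine MorleyRankGE.of_definesInjection n M ψ ⊤
    ((Term.var (Sum.inr (Sum.inl 0)) : L.Term (M ⊕ (Fin 1 ⊕ Fin 1))).equal
      (Term.var (Sum.inr (Sum.inr 0)))) ⟨?_, ?_, ?_⟩ hr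
  · intro x _
    exact ⟨x, by simp [Formula.realize_equal]⟩
  · intro x y _ _
    simp
  · intro x x' y _ _ h1 h2
    ext i
    rw [Subsingleton.elim i 0]
    simp only [Formula.realize_equal, Term.realize_var, Sum.elim_inr, Sum.elim_inl] at h1 h2
    exact h1.trans h2.symm

end

/-! ### Chain conditions on definable subgroups. -/

section

variable {L : FirstOrder.Language.{u, v}} {G : Type w} [AddCommGroup G] [L.Structure G]

open FirstOrder FirstOrder.Language

theorem hasDefinableGraph_add_left
    (hadd : (Set.univ : Set G).Definable L {a : Fin 3 → G | a 0 + a 1 = a 2}) (c : G) :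
    HasDefinableGraph L (fun x => c + x) := by
  obtain ⟨ψ, hψ⟩ := definable_univ_iff_exists_formula.1 hadd
  let r : G ⊕ Fin 3 → G ⊕ Fin 2 := Sum.elim Sum.inl ![Sum.inl c, Sum.inr 0, Sum.inr 1]
  refine definable_univ_iff_exists_formula.2 ⟨ψ.relabel r, fun x => ?_⟩
  have : Sum.elim id x ∘ r = Sum.elim id ![c, x 0, x 1] := by
    ext i
    rcases i with i | i
    · rfl
    · fin_cases i <;> rfl
  rw [Formula.realize_relabel, this, hψ]
  rfl

theorem HasMorleyRankGE.image_add_left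
    (hadd : (Set.univ : Set G).Definable L {a : Fin 3 → G | a 0 + a 1 = a 2}) {n : ℕ} {S : Set G}
    (hS : IsDefinableSet L S) (h : HasMorleyRankGE L n S) (c : G) :
    HasMorleyRankGE L n ((fun x => c + x) '' S) :=
  h.of_injOn (hS.image (hasDefinableGraph_add_left hadd c)) (hasDefinableGraph_add_left hadd c)
    (Set.mapsTo_image _ _) (add_right_injective c).injOn

/-- The descending chain condition on definable subgroups. -/
theorem AddSubgroup.exists_eq_succ_of_antitone (hfin : HasFiniteMorleyRank L G)
    (hadd : (Set.univ : Set G).Definable L {a : Fin 3 → G | a 0 + a 1 = a 2})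
    (H : ℕ → AddSubgroup G) (hdef : ∀ n, IsDefinableSet L (H n : Set G)) (hH : Antitone H) :
    ∃ n, H (n + 1) = H n := by
  by_contra! hne
  have hex : ∀ n, ∃ a ∈ H n, a ∉ H (n + 1) := fun n =>
    SetLike.exists_of_lt (lt_of_le_of_ne (hH n.le_succ) (hne n))
  choose a ha ha' using hex
  -- If the chain never stabilises, every term has rank at least every `k`. All `n` are treated at
  -- once because the induction uses later terms of the chain.
  have key : ∀ k n, HasMorleyRankGE L k (H n : Set G) := by
    intro k
    induction k with
    | zero => exact fun n => HasMorleyRankGE.zero (hdef n) ⟨0, zero_mem _⟩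
    | succ k ih =>
      intro n
      -- This coset lies in `H (n + i)` and misses `H (n + i + 1)`, which contains all later ones;
      -- hence disjointness.
      let T : ℕ → Set G := fun i => (fun x => a (n + i) + x) '' (H (n + i + 1) : Set G)
      have hT : ∀ i, ∀ z ∈ T i, z ∈ H (n + i) ∧ z ∉ H (n + i + 1) := by
        rintro i _ ⟨z, hz, rfl⟩
        exact ⟨add_mem (ha _) (hH (Nat.le_succ _) hz),
          fun h => ha' _ ((AddSubgroup.add_mem_cancel_right _ hz).1 h)⟩
      have hlt : ∀ i j, i < j → Disjoint (T i) (T j) := by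
        intro i j hij
        rw [Set.disjoint_left]
        intro z hz hz'
        exact (hT i z hz).2 (hH (by omega) (hT j z hz').1)
      refine HasMorleyRankGE.succ (hdef n) T
        (fun i => (ih _).image_add_left hadd (hdef _) _) ?_ ?_
      · intro i z hz
        exact hH (by omega) (hT i z hz).1
      · intro i j hij
        rcases lt_or_gt_of_ne hij with h | h
        · exact hlt i j h
        · exact (hlt j i h).symm
  obtain ⟨k, hk⟩ := hfin.exists_not_hasMorleyRankGE
  exact hk _ (key k 0)

/-- There is no infinite chain of definable subgroups, each of infinite index in the next. -/
theorem AddSubgroup.not_forall_exists_infinite_cosets (hfin : HasFiniteMorleyRank L G)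
    (hadd : (Set.univ : Set G).Definable L {a : Fin 3 → G | a 0 + a 1 = a 2})
    (H : ℕ → AddSubgroup G) (hdef : ∀ n, IsDefinableSet L (H n : Set G)) (hH : Monotone H) :
    ¬ ∀ n, ∃ a : ℕ → G, (∀ i, a i ∈ H (n + 1)) ∧ ∀ i j, i ≠ j → a i - a j ∉ H n := by
  intro hex
  have key : ∀ k, HasMorleyRankGE L k (H k : Set G) := by
    intro k
    induction k with
    | zero => exact HasMorleyRankGE.zero (hdef 0) ⟨0, zero_mem _⟩
    | succ k ih =>
      -- Infinitely many disjoint translates of `H k` inside `H (k + 1)` raise the rank by one.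
      obtain ⟨a, ha, ha'⟩ := hex k
      refine HasMorleyRankGE.succ (hdef _) (fun i => (fun x => a i + x) '' (H k : Set G))
        (fun i => ih.image_add_left hadd (hdef _) _) ?_ ?_
      · rintro i _ ⟨z, hz, rfl⟩
        exact add_mem (ha i) (hH k.le_succ hz)
      · intro i j hij
        rw [Set.disjoint_left]
        rintro _ ⟨z, hz, rfl⟩ ⟨z', hz', h⟩
        refine ha' i j hij ?_
        have : a i - a j = z' - z := by
          rw [sub_eq_sub_iff_add_eq_add, add_comm z']
          exact h.symm
        rw [this]
        exact sub_mem hz' hz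
  obtain ⟨k, hk⟩ := hfin.exists_not_hasMorleyRankGE
  exact hk _ (key k)

/-- If an endomorphism of `G` with definable graph maps a definable subgroup onto itself, then its
iterates have finite kernel there. -/
theorem AddMonoid.End.finite_inter_ker_of_image_eq (hfin : HasFiniteMorleyRank L G)
    (hadd : (Set.univ : Set G).Definable L {a : Fin 3 → G | a 0 + a 1 = a 2})
    (f : AddMonoid.End G) (hf : HasDefinableGraph L f) (t : AddSubgroup G)
    (ht : IsDefinableSet L (t : Set G)) (hft : f '' (t : Set G) = t) (N : ℕ) :
    {x | x ∈ t ∧ (f ^ N) x = 0}.Finite := by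
  by_contra hinf
  replace hinf : {x | x ∈ t ∧ (f ^ N) x = 0}.Infinite := hinf
  let e := hinf.natEmbedding
  have hfn : ∀ n, ⇑(f ^ n) '' (t : Set G) = (t : Set G) := by
    intro n
    induction n with
    | zero => simp
    | succ n ih =>
      rw [AddMonoid.End.coe_pow] at ih ⊢
      rw [Function.iterate_succ, Set.image_comp, hft, ih]
  let H : ℕ → AddSubgroup G := fun n => t ⊓ AddMonoidHom.ker (f ^ (N * n))
  refine AddSubgroup.not_forall_exists_infinite_cosets hfin hadd H ?_ ?_ ?_
  · intro n
    have h : (H n : Set G) = (t : Set G) ∩ f^[N * n] ⁻¹' {0} := by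
      rw [← AddMonoid.End.coe_pow]
      rfl
    rw [h]
    exact ht.inter ((isDefinableSet_singleton 0).preimage_iterate hf _)
  · refine monotone_nat_of_le_succ fun n x hx => ⟨hx.1, ?_⟩
    show (f ^ (N * (n + 1))) x = 0
    rw [Nat.mul_succ, add_comm, pow_add]
    show (f ^ N) ((f ^ (N * n)) x) = 0
    rw [show (f ^ (N * n)) x = 0 from hx.2, map_zero]
  · intro n
    -- Lifting the infinitely many elements of `t ∩ ker f ^ N` through `f ^ (N * n)`, which is onto
    -- on `t`, gives representatives of distinct cosets of `H n` in `H (n + 1)`.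
    have hy : ∀ i, ∃ y ∈ t, (f ^ (N * n)) y = e i := by
      intro i
      have : (e i : G) ∈ (t : Set G) := (e i).2.1
      rwa [← hfn (N * n)] at this
    choose y hyt hy using hy
    refine ⟨y, fun i => ⟨hyt i, ?_⟩, fun i j hij h => ?_⟩
    · show (f ^ (N * (n + 1))) (y i) = 0
      rw [Nat.mul_succ, add_comm, pow_add]
      show (f ^ N) ((f ^ (N * n)) (y i)) = 0
      rw [hy]
      exact (e i).2.2
    · have h2 : (f ^ (N * n)) (y i - y j) = 0 := h.2
      rw [map_sub, hy, hy, sub_eq_zero] at h2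
      exact hij (e.injective (Subtype.ext h2))

end

/-! ### Linear algebra of the `p`-map. -/

/-- As `p - 1 ≥ 1`, the polynomial defining the correction terms contains a bracket and vanishes.
Its coefficients are `i • s i` with `0 < i < p`, so each `s i` is zero. -/
theorem IsPMap.map_add_of_isLieAbelian {p : ℕ} [Fact p.Prime] {K : Type u} [Field K] [CharP K p]
    {g : Type v} [LieRing g] [LieAlgebra K g] {φ : g → g} (hφ : IsPMap p K φ)
    [IsLieAbelian g] (x y : g) : φ (x + y) = φ x + φ y := by
  obtain ⟨s, hs, h⟩ := hφ.pmap_add x y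
  have hp : 2 ≤ p := (Fact.out : p.Prime).two_le
  have h0 : ((LieAlgebra.ad (Polynomial K) (Polynomial K ⊗[K] g)
        ((Polynomial.X : Polynomial K) ⊗ₜ[K] x + (1 : Polynomial K) ⊗ₜ[K] y)) ^ (p - 1))
          ((1 : Polynomial K) ⊗ₜ[K] x) = 0 := by
    obtain ⟨m, hm⟩ : ∃ m, p - 1 = m + 1 := ⟨p - 2, by omega⟩
    rw [hm, pow_succ, Module.End.mul_apply, LieAlgebra.ad_apply, add_lie,
      LieAlgebra.ExtendScalars.bracket_tmul, LieAlgebra.ExtendScalars.bracket_tmul,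
      trivial_lie_zero, trivial_lie_zero, TensorProduct.tmul_zero, TensorProduct.tmul_zero,
      add_zero, map_zero]
  rw [h0] at hs
  have hsi : ∀ i ∈ Finset.Icc 1 (p - 1), s i = 0 := by
    intro i hi
    obtain ⟨hi1, hi2⟩ := Finset.mem_Icc.1 hi
    -- Extract the coefficient of `X ^ (i - 1)`.
    have hc := congrArg (fun z => TensorProduct.lid K g
      (LinearMap.rTensor g (Polynomial.lcoeff K (i - 1)) z)) hs
    simp only [map_zero, map_sum, LinearMap.rTensor_tmul, TensorProduct.lid_tmul,
      Polynomial.lcoeff_apply, Polynomial.coeff_X_pow] at hc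
    rw [Finset.sum_eq_single i] at hc
    · rw [if_pos rfl, one_smul, ← Nat.cast_smul_eq_nsmul K] at hc
      refine (smul_eq_zero.1 hc.symm).resolve_left ?_
      rw [CharP.cast_eq_zero_iff K p]
      exact fun hd => absurd (Nat.le_of_dvd hi1 hd) (by omega)
    · intro j hj hji
      have := (Finset.mem_Icc.1 hj).1
      rw [if_neg (by omega), zero_smul]
    · exact fun h => absurd hi h
  rw [h, Finset.sum_eq_zero hsi, add_zero]

/-- An invariant subspace on which an endomorphism is surjective, and which contains the range
of one of its powers, has an invariant complement. -/
theorem Module.End.exists_isCompl_invariant {K V : Type*} [Field K] [AddCommGroup V] [Module K V]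
    (f : Module.End K V) (t : Submodule K V) (ht : t.map f = t) (N : ℕ)
    (hN : LinearMap.range (f ^ N) ≤ t) :
    ∃ u : Submodule K V, u ≤ u.comap f ∧ IsCompl u t := by
  obtain ⟨u, -, hu⟩ := zorn_le_nonempty₀ {u : Submodule K V | u ≤ u.comap f ∧ Disjoint u t}
    (by
      intro c hc hchain y hy
      have hdir := hchain.directedOn
      refine ⟨sSup c, ⟨?_, ?_⟩, fun z hz => le_sSup hz⟩
      · intro x hx
        obtain ⟨z, hz, hxz⟩ := (Submodule.mem_sSup_of_directed ⟨y, hy⟩ hdir).1 hx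
        exact le_sSup hz ((hc hz).1 hxz)
      · rw [Submodule.disjoint_def]
        intro x hx hxt
        obtain ⟨z, hz, hxz⟩ := (Submodule.mem_sSup_of_directed ⟨y, hy⟩ hdir).1 hx
        exact Submodule.disjoint_def.1 (hc hz).2 x hxz hxt)
    ⊥ ⟨bot_le, disjoint_bot_left⟩
  refine ⟨u, hu.prop.1, hu.prop.2, codisjoint_iff_le_sup.2 ?_⟩
  -- Write `f x = v + f s'` with `v ∈ u` and `s' ∈ t`. Then `f (x - s') ∈ u`, so adjoining `x - s'`
  -- to `u` preserves invariance; if `x ∉ u ⊔ t` it also preserves disjointness from `t`, against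
  -- maximality.
  have step : ∀ x, f x ∈ u ⊔ t → x ∈ u ⊔ t := by
    intro x hx
    by_contra hxn
    obtain ⟨v, hv, s, hs, hvs⟩ := Submodule.mem_sup.1 hx
    rw [← ht] at hs
    obtain ⟨s', hs', rfl⟩ := hs
    have hx' : x - s' ∉ u ⊔ t := fun h => hxn
      (by simpa using add_mem h (Submodule.mem_sup_right hs'))
    have hfx : f (x - s') = v := by rw [map_sub, ← hvs, add_sub_cancel_right]
    have hmem : u ⊔ K ∙ (x - s') ∈ {u : Submodule K V | u ≤ u.comap f ∧ Disjoint u t} := by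
      refine ⟨sup_le (hu.prop.1.trans (Submodule.comap_mono le_sup_left)) ?_, ?_⟩
      · rw [Submodule.span_singleton_le_iff_mem, Submodule.mem_comap, hfx]
        exact Submodule.mem_sup_left hv
      · rw [Submodule.disjoint_def]
        intro z hz hzt
        obtain ⟨a, ha, b, hb, rfl⟩ := Submodule.mem_sup.1 hz
        obtain ⟨c, rfl⟩ := Submodule.mem_span_singleton.1 hb
        rcases eq_or_ne c 0 with rfl | hc
        · rw [zero_smul, add_zero] at hzt ⊢
          exact Submodule.disjoint_def.1 hu.prop.2 a ha hzt
        · refine absurd ?_ hx'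
          have : c • (x - s') ∈ u ⊔ t := by
            simpa using sub_mem (Submodule.mem_sup_right hzt : _ ∈ u ⊔ t)
              (Submodule.mem_sup_left ha)
          exact (Submodule.smul_mem_iff _ hc).1 this
    exact hx' (Submodule.mem_sup_left
      (hu.le_of_ge hmem le_sup_left
        (Submodule.mem_sup_right (Submodule.mem_span_singleton_self _))))
  intro x _
  have : ∀ n, ∀ x, (f ^ n) x ∈ u ⊔ t → x ∈ u ⊔ t := by
    intro n
    induction n with
    | zero => exact fun x hx => hx
    | succ n ih => exact fun x hx => step x (ih (f x) hx)
  exact this N x (Submodule.mem_sup_right (hN ⟨x, rfl⟩))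

/-- A subspace of an abelian Lie algebra, as a subalgebra. -/
def Submodule.toLieSubalgebraOfAbelian {K : Type u} [CommRing K] {g : Type v} [LieRing g]
    [LieAlgebra K g] [IsLieAbelian g] (s : Submodule K g) : LieSubalgebra K g :=
  { s with
    lie_mem' := fun {x y} _ _ => by
      rw [trivial_lie_zero]
      exact s.zero_mem }

/-- The Fitting decomposition of a linear endomorphism whose ranges stabilise. -/
theorem Module.End.ker_sup_range_pow_eq_top {K V : Type*} [Field K] [AddCommGroup V] [Module K V]
    (f : Module.End K V) (N : ℕ)
    (h : (LinearMap.range (f ^ N)).map f = LinearMap.range (f ^ N)) :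
    LinearMap.ker (f ^ N) ⊔ LinearMap.range (f ^ N) = ⊤ := by
  have hn : ∀ n, (LinearMap.range (f ^ N)).map (f ^ n) = LinearMap.range (f ^ N) := by
    intro n
    induction n with
    | zero => exact Submodule.map_id _
    | succ n ih => rw [pow_succ, Module.End.mul_eq_comp, Submodule.map_comp, h, ih]
  refine eq_top_iff.2 fun x _ => ?_
  -- `f ^ N` maps its own range onto itself, so `x` differs from some `y` in the range by an element
  -- of the kernel.
  have hx : (f ^ N) x ∈ (LinearMap.range (f ^ N)).map (f ^ N) := by
    rw [hn]
    exact ⟨x, rfl⟩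
  obtain ⟨y, hy, hyx⟩ := hx
  rw [← sub_add_cancel x y]
  refine add_mem (Submodule.mem_sup_left ?_) (Submodule.mem_sup_right hy)
  rw [LinearMap.mem_ker, map_sub, hyx, sub_self]

/-! ### The two decompositions. -/

theorem mainTheorem11 (p : ℕ) [Fact p.Prime] (L : FirstOrder.Language.{u, v}) (𝔞 : Type w)
    [LieRing 𝔞] [LieAlgebra (ZMod p) 𝔞] [L.Structure 𝔞] (φ : 𝔞 → 𝔞)
    (h𝔞 : IsPLieAlgebraOfFiniteMorleyRank p L 𝔞 φ) (hab : IsLieAbelian 𝔞) :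
    (∃ 𝔲 𝔱 : LieSubalgebra (ZMod p) 𝔞,
      IsInternalDirectSum 𝔲 𝔱 ∧
      IsPNilpotent φ 𝔲 ∧ HasBoundedExponent φ 𝔲 ∧ IsPTorus φ 𝔱) ∧
    (∃ 𝔲 𝔱 : LieSubalgebra (ZMod p) 𝔞,
      IsAlmostDirectSum 𝔲 𝔱 ∧
      IsPNilpotent φ 𝔲 ∧ HasBoundedExponent φ 𝔲 ∧ IsPTorus φ 𝔱 ∧
      IsDefinableSet L (𝔲 : Set 𝔞) ∧ IsDefinableSet L (𝔱 : Set 𝔞)) := by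
  obtain ⟨hφ, hadd, -, hgraph, hfin⟩ := h𝔞
  -- Homogeneity of degree `p` becomes linearity because `c ^ p = c` in `𝔽_p`.
  let f : Module.End (ZMod p) 𝔞 :=
    { toFun := φ
      map_add' := hφ.map_add_of_isLieAbelian
      map_smul' := fun c x => by rw [hφ.pmap_smul, ZMod.pow_card]; rfl }
  have hpow : ∀ n, ⇑(f ^ n) = φ^[n] := fun n => Module.End.coe_pow f n
  have hrange : ∀ n, (LinearMap.range (f ^ n) : Set 𝔞) = φ^[n] '' Set.univ := by
    intro n
    rw [Set.image_univ, ← hpow, LinearMap.coe_range]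
  have hmap : ∀ n, LinearMap.range (f ^ (n + 1)) = (LinearMap.range (f ^ n)).map f := by
    intro n
    rw [pow_succ', Module.End.mul_eq_comp, LinearMap.range_comp]
  obtain ⟨N, hN⟩ := AddSubgroup.exists_eq_succ_of_antitone hfin hadd
    (fun n => (LinearMap.range (f ^ n)).toAddSubgroup)
    (fun n => by
      show IsDefinableSet L (LinearMap.range (f ^ n) : Set 𝔞)
      rw [hrange]
      exact isDefinableSet_univ.image_iterate hgraph n)
    (antitone_nat_of_succ_le fun n => by
      rintro _ ⟨x, rfl⟩
      exact ⟨f x, by rw [pow_succ, Module.End.mul_apply]⟩)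
  have ht : (LinearMap.range (f ^ N)).map f = LinearMap.range (f ^ N) := by
    rw [← hmap]
    exact Submodule.toAddSubgroup_injective hN
  let 𝔱 : LieSubalgebra (ZMod p) 𝔞 := (LinearMap.range (f ^ N)).toLieSubalgebraOfAbelian
  have himage : φ '' (𝔱 : Set 𝔞) = (𝔱 : Set 𝔞) := congrArg (SetLike.coe) ht
  have htorus : IsPTorus φ 𝔱 :=
    ⟨fun x hx => himage.subset ⟨x, hx, rfl⟩, ⟨fun x y => Subtype.ext (trivial_lie_zero 𝔞 𝔞 (x : 𝔞) (y : 𝔞))⟩,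
      himage⟩
  refine ⟨?_, ?_⟩
  · obtain ⟨u, hu, hc⟩ := f.exists_isCompl_invariant _ ht N le_rfl
    have hun : ∀ n, ∀ x ∈ u, (f ^ n) x ∈ u := by
      intro n
      induction n with
      | zero => exact fun x hx => hx
      | succ n ih => exact fun x hx => ih (f x) (hu hx)
    -- For `x ∈ u`, the element `f ^ N x` lies both in `u`, by invariance, and in the torus.
    have hexp : ∀ x ∈ u, φ^[N] x = 0 := by
      intro x hx
      rw [← hpow]
      exact Submodule.disjoint_def.1 hc.disjoint _ (hun N x hx) ⟨x, rfl⟩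
    exact ⟨u.toLieSubalgebraOfAbelian, 𝔱, hc, ⟨fun x hx => hu hx, fun x hx => ⟨N, hexp x hx⟩⟩,
      ⟨N, hexp⟩, htorus⟩
  · let 𝔲 : LieSubalgebra (ZMod p) 𝔞 := (LinearMap.ker (f ^ N)).toLieSubalgebraOfAbelian
    have hker : (𝔲 : Set 𝔞) = φ^[N] ⁻¹' {0} := by
      rw [← hpow]
      rfl
    have hexp : ∀ x ∈ 𝔲, φ^[N] x = 0 := fun x hx => hker.subset hx
    have hdef : IsDefinableSet L (𝔱 : Set 𝔞) := by
      have h : (𝔱 : Set 𝔞) = φ^[N] '' Set.univ := hrange N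
      rw [h]
      exact isDefinableSet_univ.image_iterate hgraph N
    refine ⟨𝔲, 𝔱, ⟨f.ker_sup_range_pow_eq_top N ht, ?_⟩, ⟨fun x hx => ?_, fun x hx =>
      ⟨N, hexp x hx⟩⟩, ⟨N, hexp⟩, htorus, ?_, hdef⟩
    · let F : AddMonoid.End 𝔞 := f.toAddMonoidHom
      have hfinite := F.finite_inter_ker_of_image_eq hfin hadd hgraph
        (LinearMap.range (f ^ N)).toAddSubgroup hdef himage N
      refine hfinite.subset fun x hx => ⟨hx.2, ?_⟩
      rw [show ⇑(F ^ N) = φ^[N] from AddMonoid.End.coe_pow _ F N]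
      exact hexp x hx.1
    · show (f ^ N) (f x) = 0
      rw [← Module.End.mul_apply, ← pow_succ, pow_succ', Module.End.mul_apply,
        show (f ^ N) x = 0 from hx, map_zero]
    · rw [hker]
      exact (isDefinableSet_singleton 0).preimage_iterate hgraph N
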